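/- Let $f\in C^2(\mathbb{R}^n)$ and let $g:\mathbb{R}^n\to\mathbb{R}\cup\{\infty\}$ be a proper polyhedral function (its epigraph is a polyhedral set) with $\mathrm{dom}\,g\subseteq\mathbb{R}^n_+$. Put $\phi(x)=f(x)+g(x)$ and $\Phi(y)=f(y^2)+g(y^2)$, where $y^2$ is the componentwise square. For $h:\mathbb{R}^n\to\mathbb{R}\cup\{\infty\}$ let $\partial h$ be the limiting subdifferential: $v\in\hat\partial h(x)$ if $h(x)$ is finite and $h(z)\ge h(x)+\langle v,z-x\rangle+o(\|z-x\|)$ as $z\to x$; and $v\in\partial h(x)$ if $h(x)$ is finite and there are $x^k\to x$ with $h(x^k)\to h(x)$ and $v^k\in\hat\partial h(x^k)$ with $v^k\to v$. Let $\mathrm{dom}\,\partial h=\{x:\partial h(x)\ne\emptyset\}$. A proper closed function $h$ satisfies the KL property at $\bar x\in\mathrm{dom}\,\partial h$ with exponent $\alpha\in[0,1)$ if there are $\bar c>0$, $a\in(0,\infty]$ and a neighborhood $V$ of $\bar x$ such that $$\bar c(1-\alpha)\,(h(x)-h(\bar x))^{-\alpha}\,\mathrm{dist}(0,\partial h(x))\ge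 1\quad\text{for all }x\in V\text{ with }0<h(x)-h(\bar x)<a,$$ where $\mathrm{dist}(0,\emptyset)=\infty$. **Theorem.** Assume that $\phi$ is convex and that $\bar x=\bar y^2$ is a stationary point of $\phi$, i.e. $0\in\partial\phi(\bar x)$. Let $\Omega=\operatorname{argmin}_{x\in\mathbb{R}^n}\phi(x)$ and $I=\{i:\bar x_i\ne0\}$, and for $\rho\in\mathbb{R}^n_+$ let $S_\rho=\{x\in\mathbb{R}^n:|x_i-\bar x_i|\le\rho_i\ \text{for all } i\in I^c\}$, where $I^c=\{1,\dots,n\}\setminus I$. Assume that there are a neighborhood $U$ of $\bar x$ and constants $c>0$ and $\gamma\in(0,1]$ such that for all $\rho\in\mathbb{R}^n_+$ $$\mathrm{dist}(x,\Omega\cap S_\rho)\le c\,\max\{\mathrm{dist}(x,\Omega),\mathrm{dist}(x,S_\rho)\}^{\gamma}\qquad\text{for all }x\in U\cap\mathrm{dom}\,\partial\phi.$$ If $\phi$ satisfies the KL property at $\bar x$ with exponent $\alpha\in(0,1)$, then $\Phi$ satisfies the KL property at $\bar y$ with exponent $\frac{1+\beta}{2}$, where $\beta=1-\gamma(1-\alpha)$.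 -/

import Mathlib

open Set Filter Topology

namespace SquareKL

/-- A polyhedral set: the intersection of finitely many closed half-spaces. -/
def IsPolyhedralSet {F : Type*} [AddCommGroup F] [Module ℝ F] (S : Set F) : Prop :=
  ∃ (m : ℕ) (a : Fin m → F →ₗ[ℝ] ℝ) (b : Fin m → ℝ), S = {p | ∀ j, a j p ≤ b j}

/-- The epigraph of an extended real-valued function. -/
def epi {E : Type*} (h : E → EReal) : Set (E × ℝ) :=
  {p | h p.1 ≤ (p.2 : EReal)}

/-- The effective domain of an extended real-valued function. -/
def dom {E : Type*} (h : E → EReal) : Set E :=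
  {x | h x < ⊤}

/-- A function is proper if its domain is nonempty and it never takes the value `-∞`. -/
def IsProper {E : Type*} (h : E → EReal) : Prop :=
  (dom h).Nonempty ∧ ∀ x, ⊥ < h x

/-- A polyhedral function: the epigraph is a polyhedral set. -/
def IsPolyhedralFun {E : Type*} [AddCommGroup E] [Module ℝ E] (h : E → EReal) : Prop :=
  IsPolyhedralSet (epi h)

/-- A convex extended real-valued function: the epigraph is a convex set. -/
def IsConvexFun {E : Type*} [AddCommGroup E] [Module ℝ E] (h : E → EReal) : Prop :=
  Convex ℝ (epi h)

/-- The set of global minimizers. -/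
def argmin {E : Type*} (h : E → EReal) : Set E :=
  {x | ∀ z, h x ≤ h z}

section Subdifferential

variable {E : Type*} [NormedAddCommGroup E] [InnerProductSpace ℝ E]

/-- The regular (Fréchet) subdifferential at a point where `h` is finite: `v` belongs to it when
`h z ≥ h x + ⟨v, z - x⟩ + o(‖z - x‖)` as `z → x`. It is empty where `h` is not finite. -/
def regularSubdiff (h : E → EReal) (x : E) : Set E :=
  {v | h x ≠ ⊥ ∧ h x ≠ ⊤ ∧ ∀ ε : ℝ, 0 < ε → ∀ᶠ z in 𝓝 x,
    h x + ((inner ℝ v (z - x) - ε * ‖z - x‖ : ℝ) : EReal) ≤ h z}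

/-- The (limiting, Mordukhovich) subdifferential: limits of regular subgradients `vₖ` taken at
points `xₖ → x` with `h xₖ → h x`. It is empty where `h` is not finite. -/
def subdiff (h : E → EReal) (x : E) : Set E :=
  {v | h x ≠ ⊥ ∧ h x ≠ ⊤ ∧ ∃ (xs vs : ℕ → E),
    Tendsto xs atTop (𝓝 x) ∧ Tendsto (fun k => h (xs k)) atTop (𝓝 (h x)) ∧
    (∀ k, vs k ∈ regularSubdiff h (xs k)) ∧ Tendsto vs atTop (𝓝 v)}

/-- The domain of the subdifferential. -/
def domSubdiff (h : E → EReal) : Set E :=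
  {x | (subdiff h x).Nonempty}

/-- A stationary point: zero is a subgradient. -/
def IsStationary (h : E → EReal) (x : E) : Prop :=
  (0 : E) ∈ subdiff h x

/-- The proper closed function `h` satisfies the Kurdyka-Łojasiewicz property at `xbar` with
exponent `α ∈ [0, 1)`: near `xbar`, whenever `0 < h x - h xbar < a`, one has
`ψ'(h x - h xbar) * dist(0, ∂h x) ≥ 1` with `ψ s = c * s ^ (1 - α)`, so that
`ψ' s = c * (1 - α) * s ^ (-α)`. The distance is extended-valued: `dist(0, ∅) = ∞`. -/
def HasKLExponent (h : E → EReal) (xbar : E) (α : ℝ) : Prop :=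
  IsProper h ∧ LowerSemicontinuous h ∧ xbar ∈ domSubdiff h ∧ 0 ≤ α ∧ α < 1 ∧
    ∃ c : ℝ, 0 < c ∧ ∃ a : EReal, 0 < a ∧ ∃ V ∈ 𝓝 xbar, ∀ x ∈ V,
      0 < h x - h xbar → h x - h xbar < a →
        1 ≤ ENNReal.ofReal (c * (1 - α) * (h x - h xbar).toReal ^ (-α)) *
          Metric.infEDist 0 (subdiff h x)

end Subdifferential

/-- The componentwise square of a vector. -/
def sqVec {n : ℕ} (y : EuclideanSpace ℝ (Fin n)) : EuclideanSpace ℝ (Fin n) :=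
  WithLp.toLp 2 (fun i => y i ^ 2)

/-- The objective `φ = f + g`. -/
noncomputable def phi {n : ℕ} (f : EuclideanSpace ℝ (Fin n) → ℝ) (g : EuclideanSpace ℝ (Fin n) → EReal) :
    EuclideanSpace ℝ (Fin n) → EReal :=
  fun x => (f x : EReal) + g x

/-- The reparameterized objective `Φ(y) = f(y²) + g(y²)`. -/
noncomputable def bigPhi {n : ℕ} (f : EuclideanSpace ℝ (Fin n) → ℝ) (g : EuclideanSpace ℝ (Fin n) → EReal) :
    EuclideanSpace ℝ (Fin n) → EReal :=
  fun y => (f (sqVec y) : EReal) + g (sqVec y)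

/-- The box of all `x` with `|x i - xbar i| ≤ ρ i` for the indices `i ∈ J`; the other coordinates
are free. -/
def box {n : ℕ} (xbar : EuclideanSpace ℝ (Fin n)) (J : Set (Fin n)) (ρ : Fin n → ℝ) :
    Set (EuclideanSpace ℝ (Fin n)) :=
  {x | ∀ i ∈ J, |x i - xbar i| ≤ ρ i}

end SquareKL

/-!
By convexity `sqVec ybar` minimizes `φ`; put `m = min φ` and `Ω = argmin φ`. The KL inequality for
`φ` integrates to the error bound `dist(x, Ω) ≤ C (φ x - m) ^ (1 - α)`: minimize
`(φ - m) ^ (1 - α) + μ / 2 * ‖· - x‖ ^ 2` for a suitable `μ`.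

Since `g` is polyhedral, Farkas' lemma gives a chain rule without constraint qualification: every
regular subgradient `v` of `Φ` at `y` has a regular subgradient `u` of `φ` at `x = y²` with
`v i = 2 * y i * u i` wherever `y i ≠ 0`. Let `z` be the point nearest to `x` in `Ω ∩ S_ρ` with
`ρ = |x - xbar|`. On the coordinates vanishing at `xbar`, the box forces `|z i| ≤ x i`, so that
`|x i - z i| ≤ K * |y i| * √(dist x z)` on all coordinates, and convexity yields
`φ x - m ≤ ⟪u, x - z⟫ ≤ K' * √(dist x z) * ‖v‖`. The two error bounds turn `√(dist x z)` into a
multiple of `(φ x - m) ^ (γ * (1 - α) / 2)`.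
-/

namespace SquareKL

section Polyhedral

theorem mem_hull_insert_of_sub_smul_mem {ι 𝕜 W : Type*} [Ring 𝕜] [LinearOrder 𝕜]
    [IsStrictOrderedRing 𝕜] [AddCommGroup W] [Module 𝕜 W] {s : Set ι} {a : ι → W} {l : ι → 𝕜}
    {b c : W} {t : 𝕜} (hl : ∀ j ∈ s, l j ≤ 0) (ht : 0 ≤ t)
    (hc : c - t • b ∈ PointedCone.hull 𝕜 ((fun j => a j - l j • b) '' s)) :
    c ∈ PointedCone.hull 𝕜 (insert b (a '' s)) := by
  have hb : b ∈ PointedCone.hull 𝕜 (insert b (a '' s)) :=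
    PointedCone.subset_hull (mem_insert _ _)
  have hle : PointedCone.hull 𝕜 ((fun j => a j - l j • b) '' s) ≤
      PointedCone.hull 𝕜 (insert b (a '' s)) := by
    refine Submodule.span_le.2 (image_subset_iff.2 fun j hj => ?_)
    have := add_mem (PointedCone.subset_hull (mem_insert_of_mem b (mem_image_of_mem a hj)))
      (PointedCone.smul_mem _ (neg_nonneg.2 (hl j hj)) hb)
    simpa [sub_eq_add_neg] using this
  have := add_mem (hle hc) (PointedCone.smul_mem _ ht hb)
  rwa [sub_add_cancel] at this

/-- Farkas' lemma. -/
theorem mem_hull_of_forall_nonpos {ι 𝕜 V : Type*} [Field 𝕜] [LinearOrder 𝕜]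
    [IsStrictOrderedRing 𝕜] [AddCommGroup V] [Module 𝕜 V] (s : Finset ι) (a : ι → V →ₗ[𝕜] 𝕜)
    (c : V →ₗ[𝕜] 𝕜) (h : ∀ x, (∀ j ∈ s, a j x ≤ 0) → c x ≤ 0) :
    c ∈ PointedCone.hull 𝕜 (a '' s) := by
  classical
  induction s using Finset.induction_on generalizing a c with
  | empty =>
    have hc : c = 0 := by
      ext x
      have hneg := h (-x) (by simp)
      rw [map_neg, neg_nonpos] at hneg
      exact le_antisymm (h x (by simp)) hneg
    exact hc ▸ zero_mem _
  | insert k s _ ih =>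
    rw [Finset.coe_insert, image_insert_eq]
    by_cases hs : ∀ x, (∀ j ∈ s, a j x ≤ 0) → c x ≤ 0
    · exact Submodule.span_mono (subset_insert _ _) (ih a c hs)
    push Not at hs
    obtain ⟨x₁, hx₁, hcx₁⟩ := hs
    have hk : 0 < a k x₁ := by
      by_contra! hk
      exact hcx₁.not_ge (h x₁ (Finset.forall_mem_insert _ _ _ |>.2 ⟨hk, hx₁⟩))
    -- Project along `x₁` onto the kernel of `a k`, where the constraint `k` disappears.
    obtain ⟨x₀, hkx₀, hax₀, hcx₀⟩ : ∃ x₀, a k x₀ = 1 ∧ (∀ j ∈ s, a j x₀ ≤ 0) ∧ 0 < c x₀ :=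
      ⟨(a k x₁)⁻¹ • x₁, by simp [hk.ne'], fun j hj => by
        simpa using mul_nonpos_of_nonneg_of_nonpos (inv_nonneg.2 hk.le) (hx₁ j hj),
        by simpa using mul_pos (inv_pos.2 hk) hcx₁⟩
    refine mem_hull_insert_of_sub_smul_mem hax₀ hcx₀.le (ih _ _ fun x hx => ?_)
    have := h (x - a k x • x₀) <| Finset.forall_mem_insert _ _ _ |>.2
      ⟨by simp [hkx₀], fun j hj => by simpa [mul_comm] using hx j hj⟩
    simpa [mul_comm] using this

variable {F V : Type*} [AddCommGroup F] [Module ℝ F] [AddCommGroup V] [Module ℝ V]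

theorem eventually_add_smul_le {a : F →ₗ[ℝ] ℝ} {b : ℝ} {p d : F} (hp : a p ≤ b)
    (hd : a p = b → a d ≤ 0) : ∀ᶠ s : ℝ in 𝓝[>] 0, a (p + s • d) ≤ b := by
  simp only [map_add, map_smul, smul_eq_mul]
  rcases hp.eq_or_lt with hb | hb
  · filter_upwards [self_mem_nhdsWithin] with s hs
    linarith [mul_nonpos_of_nonneg_of_nonpos (le_of_lt hs) (hd hb)]
  · have hcont : Continuous fun s : ℝ => a p + s * a d := by fun_prop
    exact nhdsWithin_le_nhds <| ((hcont.tendsto 0).eventually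
      (gt_mem_nhds (by simpa using hb))).mono fun s hs => hs.le

/-- Polyhedrality replaces a constraint qualification on the range of `Q`. -/
theorem IsPolyhedralSet.exists_normal_comp_eq {S : Set F} (hS : IsPolyhedralSet S) {p : F}
    (hp : p ∈ S) (Q : V →ₗ[ℝ] F) (c : V →ₗ[ℝ] ℝ)
    (hc : ∀ d, (∀ᶠ s : ℝ in 𝓝[>] 0, p + s • Q d ∈ S) → c d ≤ 0) :
    ∃ A : F →ₗ[ℝ] ℝ, (∀ q ∈ S, A q ≤ A p) ∧ A ∘ₗ Q = c := by
  classical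
  obtain ⟨m, a, b, rfl⟩ := hS
  let active : Finset (Fin m) := {j | a j p = b j}
  have hfarkas : c ∈ PointedCone.hull ℝ ((fun j => a j ∘ₗ Q) '' active) :=
    mem_hull_of_forall_nonpos _ _ _ fun d hd => hc d <| eventually_all.2 fun j =>
      eventually_add_smul_le (hp j) fun hj => hd j (by simpa [active] using hj)
  clear hc
  induction hfarkas using Submodule.span_induction with
  | mem _ h =>
    obtain ⟨j, hj, rfl⟩ := h
    have hj : a j p = b j := by simpa [active] using hj
    exact ⟨a j, fun q hq => (hq j).trans hj.ge, rfl⟩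
  | zero => exact ⟨0, by simp, by simp⟩
  | add _ _ _ _ h₁ h₂ =>
    obtain ⟨⟨A₁, hA₁, rfl⟩, A₂, hA₂, rfl⟩ := And.intro h₁ h₂
    exact ⟨A₁ + A₂, fun q hq => add_le_add (hA₁ q hq) (hA₂ q hq), LinearMap.add_comp ..⟩
  | smul l _ _ h =>
    obtain ⟨A, hA, rfl⟩ := h
    exact ⟨(l : ℝ) • A, fun q hq => smul_le_smul_of_nonneg_left (hA q hq) l.2,
      LinearMap.smul_comp ..⟩

end Polyhedral

section Epigraph

theorem coe_le_iff_forall_coe {s : ℝ} {e : EReal} :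
    (s : EReal) ≤ e ↔ ∀ t : ℝ, e ≤ t → s ≤ t :=
  ⟨fun hs _ ht => EReal.coe_le_coe_iff.1 (hs.trans ht), fun hs =>
    EReal.le_of_forall_lt_iff_le.1 fun t ht => EReal.coe_le_coe_iff.2 (hs t ht.le)⟩

variable {E : Type*} [TopologicalSpace E] {h : E → EReal}

theorem isClosed_epi (hl : LowerSemicontinuous h) : IsClosed (epi h) :=
  hl.isClosed_epigraph.preimage (f := fun p : E × ℝ => (p.1, (p.2 : EReal)))
    (continuous_fst.prodMk (continuous_coe_real_ereal.comp continuous_snd))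

theorem isClosed_argmin (hl : LowerSemicontinuous h) : IsClosed (argmin h) := by
  simp only [argmin, ofPred_forall]
  exact isClosed_iInter fun z => hl.isClosed_preimage (h z)

end Epigraph

section Subgradients

variable {E : Type*} [NormedAddCommGroup E] [InnerProductSpace ℝ E] {h : E → EReal} {x v : E}
  {r : ℝ}

theorem mem_regularSubdiff_iff (hr : h x = r) :
    v ∈ regularSubdiff h x ↔ ∀ ε : ℝ, 0 < ε → ∀ᶠ z in 𝓝 x, ∀ t : ℝ, h z ≤ t →
      r + (inner ℝ v (z - x) - ε * ‖z - x‖) ≤ t := by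
  simp only [regularSubdiff, mem_ofPred_eq, hr, ← EReal.coe_add, coe_le_iff_forall_coe]
  simp

theorem regularSubdiff_subset_subdiff (h : E → EReal) (x : E) :
    regularSubdiff h x ⊆ subdiff h x := fun v hv =>
  ⟨hv.1, hv.2.1, fun _ => x, fun _ => v, tendsto_const_nhds, tendsto_const_nhds,
    fun _ => hv, tendsto_const_nhds⟩

theorem exists_real_of_mem_subdiff (hv : v ∈ subdiff h x) : ∃ r : ℝ, h x = r :=
  ⟨(h x).toReal, (EReal.coe_toReal hv.2.1 hv.1).symm⟩

theorem exists_seq_of_mem_subdiff (hr : h x = r) (hv : v ∈ subdiff h x) :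
    ∃ (xs vs : ℕ → E) (rs : ℕ → ℝ), Tendsto xs atTop (𝓝 x) ∧ Tendsto rs atTop (𝓝 r) ∧
      Tendsto vs atTop (𝓝 v) ∧ ∀ k, h (xs k) = rs k ∧ vs k ∈ regularSubdiff h (xs k) := by
  obtain ⟨-, -, xs, vs, hxs, hhs, hvs, hv⟩ := hv
  choose rs hrs using fun k =>
    exists_real_of_mem_subdiff (regularSubdiff_subset_subdiff _ _ (hvs k))
  simp only [hr, hrs, EReal.tendsto_coe] at hhs
  exact ⟨xs, vs, rs, hxs, hhs, hv, fun k => ⟨hrs k, hvs k⟩⟩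

theorem zero_mem_regularSubdiff_of_mem_argmin (hr : h x = r) (hx : x ∈ argmin h) :
    (0 : E) ∈ regularSubdiff h x := by
  refine (mem_regularSubdiff_iff hr).2 fun ε hε => Eventually.of_forall fun z t ht => ?_
  have hrt : r ≤ t := EReal.coe_le_coe_iff.1 (hr ▸ (hx z).trans ht)
  have : 0 ≤ ε * ‖z - x‖ := by positivity
  simp only [inner_zero_left]
  linarith

theorem inner_le_of_mem_regularSubdiff_of_hasDerivAt {Y : ℝ → E} {Y' : E} {θ : ℝ → ℝ} {θ' : ℝ}
    (hv : v ∈ regularSubdiff h x) (hY : HasDerivAt Y Y' 0) (hY₀ : Y 0 = x)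
    (hθ : HasDerivAt θ θ' 0) (hθ₀ : h x = θ 0) (hle : ∀ᶠ s in 𝓝[>] 0, h (Y s) ≤ θ s) :
    inner ℝ v Y' ≤ θ' := by
  have hslopeY := hY.tendsto_slope_zero_right
  have hslopeθ := hθ.tendsto_slope_zero_right
  have hYx : Tendsto Y (𝓝[>] 0) (𝓝 x) :=
    hY₀ ▸ hY.continuousAt.tendsto.mono_left nhdsWithin_le_nhds
  simp only [zero_add, hY₀] at hslopeY hslopeθ
  have hε (ε : ℝ) (hε : 0 < ε) : inner ℝ v Y' ≤ θ' + ε * ‖Y'‖ := by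
    refine le_of_tendsto_of_tendsto (tendsto_const_nhds.inner hslopeY)
      (hslopeθ.add (hslopeY.norm.const_mul ε)) ?_
    filter_upwards [hle, hYx.eventually ((mem_regularSubdiff_iff hθ₀).1 hv ε hε),
      self_mem_nhdsWithin] with s hs hsub (hs₀ : 0 < s)
    rw [inner_smul_right, norm_smul, Real.norm_of_nonneg (inv_nonneg.2 hs₀.le), smul_eq_mul]
    refine le_of_mul_le_mul_left ?_ hs₀
    field_simp
    linarith [hsub _ hs]
  have hlim : Tendsto (fun ε : ℝ => θ' + ε * ‖Y'‖) (𝓝[>] 0) (𝓝 θ') := by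
    have : Continuous fun ε : ℝ => θ' + ε * ‖Y'‖ := by fun_prop
    simpa using (this.tendsto 0).mono_left nhdsWithin_le_nhds
  exact ge_of_tendsto hlim (eventually_mem_nhdsWithin.mono hε)

theorem IsConvexFun.add_inner_le_of_mem_regularSubdiff (hc : IsConvexFun h) (hr : h x = r)
    (hv : v ∈ regularSubdiff h x) {z : E} {t : ℝ} (ht : h z ≤ t) :
    r + inner ℝ v (z - x) ≤ t := by
  have hY : HasDerivAt (fun s : ℝ => x + s • (z - x)) (z - x) 0 := by
    simpa using ((hasDerivAt_id (0 : ℝ)).smul_const (z - x)).const_add x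
  have hθ : HasDerivAt (fun s : ℝ => r + s * (t - r)) (t - r) 0 := by
    simpa using ((hasDerivAt_id (0 : ℝ)).mul_const (t - r)).const_add r
  have hle : ∀ᶠ s : ℝ in 𝓝[>] 0, h (x + s • (z - x)) ≤ ((r + s * (t - r) : ℝ) : EReal) := by
    filter_upwards [Ioo_mem_nhdsGT one_pos] with s hs
    exact hc.add_smul_sub_mem (x := (x, r)) (y := (z, t)) hr.le ht ⟨hs.1.le, hs.2.le⟩
  linarith [inner_le_of_mem_regularSubdiff_of_hasDerivAt hv hY (by simp) hθ (by simpa) hle]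

theorem IsConvexFun.add_inner_le_of_mem_subdiff (hc : IsConvexFun h) (hr : h x = r)
    (hv : v ∈ subdiff h x) {z : E} {t : ℝ} (ht : h z ≤ t) : r + inner ℝ v (z - x) ≤ t := by
  obtain ⟨xs, vs, rs, hxs, hrs, hvs, hsub⟩ := exists_seq_of_mem_subdiff hr hv
  exact le_of_tendsto' (hrs.add (hvs.inner (tendsto_const_nhds.sub hxs))) fun k =>
    hc.add_inner_le_of_mem_regularSubdiff (hsub k).1 (hsub k).2 ht

theorem IsConvexFun.mem_argmin_of_isStationary (hc : IsConvexFun h) (hx : IsStationary h x) :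
    x ∈ argmin h := fun z => by
  obtain ⟨r, hr⟩ := exists_real_of_mem_subdiff hx
  rw [hr, coe_le_iff_forall_coe]
  intro t ht
  simpa using hc.add_inner_le_of_mem_subdiff hr hx ht

/-- Fermat's rule for `ψ ∘ h + p`, solved for the subgradient of `h`. -/
theorem smul_mem_regularSubdiff_of_forall_le {ψ : ℝ → ℝ} {ψ' m : ℝ} {p : E → ℝ} {u : E}
    (hr : h x = r) (hm : ∀ z, (m : EReal) ≤ h z) (hψ : HasDerivAt ψ ψ' r) (hψ' : 0 < ψ')
    (hmono : StrictMonoOn ψ (Ici m)) (hp : HasFDerivAt p (innerSL ℝ u) x)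
    (hmin : ∀ z, ∀ t : ℝ, h z ≤ t → ψ r + p x ≤ ψ t + p z) :
    (-ψ'⁻¹) • u ∈ regularSubdiff h x := by
  set v := (-ψ'⁻¹) • u with hvdef
  refine (mem_regularSubdiff_iff hr).2 fun ε hε => ?_
  set τ : E → ℝ := fun z => r + (inner ℝ v (z - x) - ε * ‖z - x‖) with hτdef
  have hτ : Tendsto τ (𝓝 x) (𝓝 r) := by
    have : Continuous τ := by fun_prop
    simpa [hτdef] using this.tendsto x
  have hτO : (fun z => τ z - r) =O[𝓝 x] fun z => z - x := by
    refine .of_bound (‖v‖ + ε) (Eventually.of_forall fun z => ?_)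
    have := abs_real_inner_le_norm v (z - x)
    simp only [hτdef, add_sub_cancel_left, Real.norm_eq_abs]
    refine (abs_sub _ _).trans ?_
    rw [abs_of_nonneg (by positivity : 0 ≤ ε * ‖z - x‖)]
    linarith
  have hψτ := ((hψ.isLittleO.comp_tendsto hτ).trans_isBigO hτO).def
    (show 0 < ε * ψ' / 3 by positivity)
  filter_upwards [hψτ, hp.isLittleO.def (show 0 < ε * ψ' / 3 by positivity)]
    with z hψz hpz t ht
  by_contra! hlt
  have hmt : m ≤ t := EReal.coe_le_coe_iff.1 ((hm z).trans ht)
  have hψt : ψ t < ψ (τ z) := hmono hmt (hmt.trans hlt.le) hlt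
  have hlin : (τ z - r) * ψ' = -inner ℝ u (z - x) - ε * ψ' * ‖z - x‖ := by
    simp only [hτdef, hvdef, inner_smul_left, conj_trivial]
    field_simp
    ring
  simp only [Function.comp_apply, innerSL_apply_apply, smul_eq_mul, Real.norm_eq_abs] at hψz hpz
  have : 0 ≤ ε * ψ' * ‖z - x‖ := by positivity
  linarith [hmin z t ht, (abs_le.1 hψz).2, (abs_le.1 hpz).2]

end Subgradients

section KurdykaLojasiewicz

theorem one_le_ofReal_mul_infEDist_iff {E : Type*} [SeminormedAddCommGroup E] {κ s α : ℝ}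
    (hκ : 0 < κ) (hs : 0 < s) (S : Set E) :
    1 ≤ ENNReal.ofReal (κ * s ^ (-α)) * Metric.infEDist 0 S ↔ ∀ v ∈ S, s ^ α ≤ κ * ‖v‖ := by
  have hpos : 0 < κ * s ^ (-α) := by positivity
  rw [mul_comm, ← ENNReal.div_le_iff_le_mul (.inl (ENNReal.ofReal_pos.2 hpos).ne')
    (.inl ENNReal.ofReal_ne_top), Metric.le_infEDist]
  refine forall₂_congr fun v _ => ?_
  rw [edist_zero_left, ← enorm_eq_nnnorm, ← ofReal_norm, one_div, ← ENNReal.ofReal_inv_of_pos hpos,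
    ENNReal.ofReal_le_ofReal_iff (norm_nonneg v), Real.rpow_neg hs.le, mul_inv, inv_inv,
    inv_mul_le_iff₀ hκ]

theorem strictMonoOn_sub_rpow {p : ℝ} (hp : 0 < p) (m : ℝ) :
    StrictMonoOn (fun t : ℝ => (t - m) ^ p) (Ici m) := fun _ ht _ _ htu =>
  Real.rpow_lt_rpow (sub_nonneg.2 ht) (sub_lt_sub_right htu m) hp

section Minimizer

variable {E : Type*} [SeminormedAddCommGroup E] [ProperSpace E] {h : E → EReal} {x : E}
  {m r μ : ℝ} {ψ : ℝ → ℝ}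

theorem exists_mem_epi_forall_le_add_sq_norm (hl : LowerSemicontinuous h)
    (hm : ∀ z, (m : EReal) ≤ h z) (hψ : ContinuousOn ψ (Ici m)) (hmono : MonotoneOn ψ (Ici m))
    (hμ : 0 < μ) (hr : h x = r) :
    ∃ p ∈ epi h, ∀ (w : E) (t : ℝ), h w ≤ t →
      ψ p.2 + μ / 2 * ‖p.1 - x‖ ^ 2 ≤ ψ t + μ / 2 * ‖w - x‖ ^ 2 := by
  have hmr : m ≤ r := EReal.coe_le_coe_iff.1 (hr ▸ hm x)
  have hm_le {w : E} {t : ℝ} (ht : h w ≤ t) : m ≤ t := EReal.coe_le_coe_iff.1 ((hm w).trans ht)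
  obtain ⟨ρ, hρ₀, hρ⟩ : ∃ ρ, 0 ≤ ρ ∧ μ / 2 * ρ ^ 2 = ψ r - ψ m := by
    have : 0 ≤ ψ r - ψ m := sub_nonneg.2 (hmono self_mem_Ici hmr hmr)
    refine ⟨√(2 / μ * (ψ r - ψ m)), Real.sqrt_nonneg _, ?_⟩
    rw [Real.sq_sqrt (by positivity)]
    field_simp
  let K : Set (E × ℝ) := Metric.closedBall x ρ ×ˢ Icc m r ∩ epi h
  have hK : IsCompact K := ((isCompact_closedBall x ρ).prod isCompact_Icc).inter_right
    (isClosed_epi hl)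
  have hxK : (x, r) ∈ K := ⟨⟨Metric.mem_closedBall_self hρ₀, hmr, le_rfl⟩, hr.le⟩
  have hcont : ContinuousOn (fun p : E × ℝ => ψ p.2 + μ / 2 * ‖p.1 - x‖ ^ 2) K :=
    (hψ.comp continuousOn_snd fun p hp => hp.1.2.1).add (by fun_prop)
  obtain ⟨⟨z, s⟩, hzs, hmin⟩ := hK.exists_isMinOn ⟨_, hxK⟩ hcont
  refine ⟨(z, s), hzs.2, fun w t ht => ?_⟩
  have hxr : ψ s + μ / 2 * ‖z - x‖ ^ 2 ≤ ψ r := by simpa using hmin hxK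
  by_cases hw : w ∈ Metric.closedBall x ρ
  · rcases le_total t r with htr | hrt
    · exact hmin (a := (w, t)) ⟨⟨hw, hm_le ht, htr⟩, ht⟩
    · have : 0 ≤ μ / 2 * ‖w - x‖ ^ 2 := by positivity
      linarith [hmono hmr (hm_le ht) hrt]
  · rw [mem_closedBall_iff_norm, not_le] at hw
    have : μ / 2 * ρ ^ 2 ≤ μ / 2 * ‖w - x‖ ^ 2 := by gcongr
    linarith [hmono self_mem_Ici (hm_le ht) (hm_le ht)]

theorem exists_forall_le_add_sq_norm (hl : LowerSemicontinuous h)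
    (hm : ∀ z, (m : EReal) ≤ h z) (hψ : ContinuousOn ψ (Ici m)) (hmono : MonotoneOn ψ (Ici m))
    (hμ : 0 < μ) (hr : h x = r) :
    ∃ (z : E) (s : ℝ), h z = s ∧ ∀ (w : E) (t : ℝ), h w ≤ t →
      ψ s + μ / 2 * ‖z - x‖ ^ 2 ≤ ψ t + μ / 2 * ‖w - x‖ ^ 2 := by
  have hm_le {w : E} {t : ℝ} (ht : h w ≤ t) : m ≤ t := EReal.coe_le_coe_iff.1 ((hm w).trans ht)
  obtain ⟨⟨z, s⟩, hzs, hmin⟩ := exists_mem_epi_forall_le_add_sq_norm hl hm hψ hmono hμ hr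
  obtain ⟨s', hs'⟩ : ∃ s' : ℝ, h z = s' := by
    induction hz : h z with
    | bot => simpa [hz] using hm z
    | coe s' => exact ⟨s', rfl⟩
    | top => simp [epi, hz] at hzs
  have hs's : s' ≤ s := EReal.coe_le_coe_iff.1 (hs' ▸ hzs)
  refine ⟨z, s', hs', fun w t ht => le_trans ?_ (hmin w t ht)⟩
  gcongr
  exact hmono (hm_le hs'.le) (hm_le hzs) hs's

end Minimizer

variable {E : Type*} [NormedAddCommGroup E] [InnerProductSpace ℝ E] {h : E → EReal} {x : E}
  {α m r c : ℝ}

theorem rpow_le_mul_norm_of_mem_subdiff {a : ℝ} (hr : h x = r) (hmr : m < r) (hra : r < m + a)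
    (hreg : ∀ᶠ z in 𝓝 x, ∀ s : ℝ, h z = s → m < s → s < m + a → ∀ v ∈ regularSubdiff h z,
      (s - m) ^ α ≤ c * ‖v‖) :
    ∀ v ∈ subdiff h x, (r - m) ^ α ≤ c * ‖v‖ := by
  intro v hv
  obtain ⟨xs, vs, rs, hxs, hrs, hvs, hsub⟩ := exists_seq_of_mem_subdiff hr hv
  have hpow := (hrs.sub_const m).rpow_const (p := α) (.inl (sub_pos.2 hmr).ne')
  refine le_of_tendsto_of_tendsto hpow (hvs.norm.const_mul c) ?_
  filter_upwards [hxs.eventually hreg, hrs.eventually (lt_mem_nhds hmr),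
    hrs.eventually (gt_mem_nhds hra)] with k hk hmk hka
  exact hk _ (hsub k).1 hmk hka _ (hsub k).2

/-- The KL property only has to be tested on regular subgradients, and in real terms. -/
theorem hasKLExponent_iff (hm : h x = m) :
    HasKLExponent h x α ↔ IsProper h ∧ LowerSemicontinuous h ∧ x ∈ domSubdiff h ∧ 0 ≤ α ∧ α < 1 ∧
      ∃ c > 0, ∃ a > 0, ∀ᶠ z in 𝓝 x, ∀ r : ℝ, h z = r → m < r → r < m + a →
        ∀ v ∈ regularSubdiff h z, (r - m) ^ α ≤ c * ‖v‖ := by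
  refine and_congr_right' <| and_congr_right' <| and_congr_right' <| and_congr_right' <|
    and_congr_right fun hα => ?_
  have hα' : 0 < 1 - α := sub_pos.2 hα
  constructor
  · rintro ⟨c, hc, a, ha, V, hV, hKL⟩
    obtain ⟨a', ha'₀, ha'⟩ := EReal.lt_iff_exists_real_btwn.1 ha
    refine ⟨c * (1 - α), by positivity, a', EReal.coe_pos.1 ha'₀, ?_⟩
    filter_upwards [hV] with z hz r hr hmr hra v hv
    have hgap : h z - h x = ((r - m : ℝ) : EReal) := by rw [hr, hm, EReal.coe_sub]
    have hlt : ((r - m : ℝ) : EReal) < a :=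
      (EReal.coe_lt_coe_iff.2 (sub_left_lt_of_lt_add hra)).trans ha'
    have := hKL z hz (hgap ▸ EReal.coe_pos.2 (sub_pos.2 hmr)) (hgap ▸ hlt)
    rw [hgap, EReal.toReal_coe, one_le_ofReal_mul_infEDist_iff (by positivity) (sub_pos.2 hmr)]
      at this
    exact this v (regularSubdiff_subset_subdiff h z hv)
  · rintro ⟨c, hc, a, ha, hreg⟩
    refine ⟨c / (1 - α), by positivity, a, EReal.coe_pos.2 ha, _, eventually_eventually_nhds.2 hreg,
      fun z hz hpos hlt => ?_⟩
    obtain ⟨r, hr⟩ : ∃ r : ℝ, h z = r := by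
      induction hz' : h z with
      | bot => simp [hz', hm] at hpos
      | coe r => exact ⟨r, rfl⟩
      | top => simp [hz', hm] at hlt
    rw [hr, hm, ← EReal.coe_sub] at hpos hlt ⊢
    have hmr := sub_pos.1 (EReal.coe_pos.1 hpos)
    rw [div_mul_cancel₀ _ hα'.ne', EReal.toReal_coe, one_le_ofReal_mul_infEDist_iff hc
      (sub_pos.2 hmr)]
    exact rpow_le_mul_norm_of_mem_subdiff hr hmr
      (lt_add_of_sub_left_lt (EReal.coe_lt_coe_iff.1 hlt)) hz

theorem le_mul_norm_of_forall_le_add_sq_norm {s μ : ℝ} {z : E} (hm : ∀ z, (m : EReal) ≤ h z)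
    (hα : α < 1) (hc : 0 < c) (hs : h z = s) (hms : m < s)
    (hmin : ∀ (w : E) (t : ℝ), h w ≤ t →
      (s - m) ^ (1 - α) + μ / 2 * ‖z - x‖ ^ 2 ≤ (t - m) ^ (1 - α) + μ / 2 * ‖w - x‖ ^ 2)
    (hKL : ∀ v ∈ regularSubdiff h z, (s - m) ^ α ≤ c * ‖v‖) :
    (1 - α) / c ≤ ‖μ • (z - x)‖ := by
  have hα' : 0 < 1 - α := sub_pos.2 hα
  have hsm : 0 < s - m := sub_pos.2 hms
  have hψ : HasDerivAt (fun t : ℝ => (t - m) ^ (1 - α)) ((1 - α) * (s - m) ^ (-α)) s := by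
    simpa using ((hasDerivAt_id s).sub_const m).rpow_const (p := 1 - α) (.inl hsm.ne')
  have hp : HasFDerivAt (fun w : E => μ / 2 * ‖w - x‖ ^ 2) (innerSL ℝ (μ • (z - x))) z := by
    refine (((hasFDerivAt_id z).sub_const x).norm_sq.const_mul (μ / 2)).congr_fderiv ?_
    ext w
    simp only [id_eq, map_sub, ContinuousLinearMap.comp_id, smul_apply, sub_apply,
      coe_innerSL_apply, nsmul_eq_mul, Nat.cast_ofNat, smul_eq_mul, map_smul]
    ring
  have hle := hKL _ (smul_mem_regularSubdiff_of_forall_le hs hm hψ (by positivity)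
    (strictMonoOn_sub_rpow hα' m) hp fun w t => hmin w t)
  have hpow : 0 < (s - m) ^ α := by positivity
  rw [norm_smul, norm_neg, norm_inv, Real.norm_of_nonneg (by positivity), Real.rpow_neg hsm.le]
    at hle
  field_simp at hle
  rwa [div_le_iff₀' hc]

variable [ProperSpace E]

/-- Minimizing `(h - m) ^ (1 - α) + μ / 2 * ‖· - x‖ ^ 2` for a suitable `μ` lands on `{h = m}`, as
the KL inequality keeps the slope of `(h - m) ^ (1 - α)` off `{h = m}` above `(1 - α) / c`. -/
theorem exists_dist_le_of_rpow_le_mul_norm (hl : LowerSemicontinuous h)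
    (hm : ∀ z, (m : EReal) ≤ h z) (hα : α < 1) (hc : 0 < c) (hr : h x = r)
    (hKL : ∀ z ∈ Metric.closedBall x (2 * c / (1 - α) * (r - m) ^ (1 - α)), ∀ s : ℝ, h z = s →
      m < s → s ≤ r → ∀ v ∈ regularSubdiff h z, (s - m) ^ α ≤ c * ‖v‖) :
    ∃ z, h z = m ∧ dist z x ≤ 2 * c / (1 - α) * (r - m) ^ (1 - α) := by
  have hα' : 0 < 1 - α := sub_pos.2 hα
  have hmr : m ≤ r := EReal.coe_le_coe_iff.1 (hr ▸ hm x)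
  rcases hmr.eq_or_lt with rfl | hmr
  · exact ⟨x, hr, by simp [hα'.ne']⟩
  set e := (r - m) ^ (1 - α)
  set κ := (1 - α) / c with hκ
  have he₀ : 0 < e := Real.rpow_pos_of_pos (sub_pos.2 hmr) _
  have hκ₀ : 0 < κ := by positivity
  have hmono := strictMonoOn_sub_rpow hα' m
  have hcont : Continuous fun t => (t - m) ^ (1 - α) :=
    (continuous_id.sub continuous_const).rpow_const fun _ => .inr hα'.le
  obtain ⟨z, s, hs, hmin⟩ := exists_forall_le_add_sq_norm (μ := κ ^ 2 / (2 * e)) hl hm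
    hcont.continuousOn hmono.monotoneOn (by positivity) hr
  have hms : m ≤ s := EReal.coe_le_coe_iff.1 (hs ▸ hm z)
  have hs₀ : 0 ≤ (s - m) ^ (1 - α) := Real.rpow_nonneg (sub_nonneg.2 hms) _
  have hval : (s - m) ^ (1 - α) + κ ^ 2 / (2 * e) / 2 * ‖z - x‖ ^ 2 ≤ e := by
    simpa using hmin x r hr.le
  have hsq : (κ * ‖z - x‖) ^ 2 + 4 * e * (s - m) ^ (1 - α) ≤ (2 * e) ^ 2 := by
    field_simp at hval
    linarith
  have hdist : dist z x ≤ 2 * c / (1 - α) * e := by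
    have : κ * ‖z - x‖ ≤ 2 * e := le_of_sq_le_sq (by nlinarith) (by positivity)
    rw [hκ] at this
    rw [dist_eq_norm]
    field_simp at this ⊢
    exact this
  rcases hms.eq_or_lt with rfl | hms
  · exact ⟨z, hs, hdist⟩
  have hsr : s ≤ r := (hmono.le_iff_le hms.le hmr.le).1 <|
    (le_add_of_nonneg_right (by positivity)).trans hval
  have hslope : κ ≤ ‖(κ ^ 2 / (2 * e)) • (z - x)‖ :=
    le_mul_norm_of_forall_le_add_sq_norm hm hα hc hs hms hmin (hKL z hdist s hs hms hsr)
  have hlow : 2 * e ≤ κ * ‖z - x‖ := by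
    rw [norm_smul, Real.norm_of_nonneg (by positivity)] at hslope
    field_simp at hslope
    linarith
  have : 0 < (s - m) ^ (1 - α) := Real.rpow_pos_of_pos (sub_pos.2 hms) _
  nlinarith

theorem HasKLExponent.exists_infDist_argmin_le {x₀ : E} (hKL : HasKLExponent h x₀ α)
    (hm : h x₀ = m) (hx₀ : x₀ ∈ argmin h) :
    ∃ C > 0, ∃ a > 0, ∀ᶠ x in 𝓝 x₀, ∀ r : ℝ, h x = r → r < m + a →
      Metric.infDist x (argmin h) ≤ C * (r - m) ^ (1 - α) := by
  obtain ⟨-, hl, -, -, hα, c, hc, a, ha, hreg⟩ := (hasKLExponent_iff hm).1 hKL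
  obtain ⟨R, hR, hball⟩ := Metric.eventually_nhds_iff_ball.1 hreg
  refine ⟨2 * c / (1 - α), div_pos (by positivity) (sub_pos.2 hα), a, ha, ?_⟩
  filter_upwards [Metric.ball_mem_nhds x₀ (half_pos hR)] with x hx r hr hra
  by_cases hfar : R / 2 ≤ 2 * c / (1 - α) * (r - m) ^ (1 - α)
  · exact (Metric.infDist_le_dist_of_mem hx₀).trans ((Metric.mem_ball.1 hx).le.trans hfar)
  have hsub : Metric.closedBall x (2 * c / (1 - α) * (r - m) ^ (1 - α)) ⊆ Metric.ball x₀ R :=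
    Metric.closedBall_subset_ball' (by linarith [Metric.mem_ball.1 hx])
  obtain ⟨z, hz, hdist⟩ := exists_dist_le_of_rpow_le_mul_norm hl (fun z => hm ▸ hx₀ z) hα hc hr
    fun z hz s hs hms hsr => hball z (hsub hz) s hs hms (hsr.trans_lt hra)
  rw [dist_comm] at hdist
  exact (Metric.infDist_le_dist_of_mem fun w => hz ▸ hm ▸ hx₀ w).trans hdist

end KurdykaLojasiewicz

section Squaring

variable {n : ℕ} {f : EuclideanSpace ℝ (Fin n) → ℝ} {g : EuclideanSpace ℝ (Fin n) → EReal}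

/-- Componentwise multiplication by `w`, i.e. the linear map with matrix `diag w`. The derivative of
`sqVec` at `y` is `2 • hadamard y`. -/
noncomputable def hadamard (w : EuclideanSpace ℝ (Fin n)) :
    EuclideanSpace ℝ (Fin n) →ₗ[ℝ] EuclideanSpace ℝ (Fin n) :=
  Matrix.toEuclideanLin (Matrix.diagonal w)

@[simp]
theorem hadamard_apply (w d : EuclideanSpace ℝ (Fin n)) (i : Fin n) :
    hadamard w d i = w i * d i := by
  simp [hadamard, Matrix.mulVec_diagonal]

@[simp]
theorem sqVec_apply (y : EuclideanSpace ℝ (Fin n)) (i : Fin n) : sqVec y i = y i ^ 2 := rfl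

theorem continuous_sqVec : Continuous (sqVec : EuclideanSpace ℝ (Fin n) → _) :=
  (PiLp.continuous_toLp 2 _).comp (by fun_prop)

theorem exists_hasDerivAt_sqVec_eq (y d : EuclideanSpace ℝ (Fin n)) :
    ∃ Y : ℝ → EuclideanSpace ℝ (Fin n), HasDerivAt Y ((2 : ℝ)⁻¹ • hadamard y d) 0 ∧ Y 0 = y ∧
      ∀ᶠ s in 𝓝 0, sqVec (Y s) = sqVec y + s • hadamard (sqVec y) d := by
  refine ⟨fun s => WithLp.toLp 2 fun i => y i * √(1 + s * d i), ?_, by ext; simp, ?_⟩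
  · refine ((PiLp.hasFDerivAt_toLp 2 _).comp_hasDerivAt 0 (hasDerivAt_pi.2 fun i =>
      (HasDerivAt.sqrt (((hasDerivAt_id (0 : ℝ)).mul_const (d i)).const_add 1)
        (by simp)).const_mul (y i))).congr_deriv ?_
    ext i
    simp only [one_mul, id_eq, zero_mul, add_zero, Real.sqrt_one, mul_one,
      ContinuousLinearEquiv.coe_coe, PiLp.continuousLinearEquiv_symm_apply, PiLp.smul_apply,
      hadamard_apply, smul_eq_mul]
    ring
  · have hpos (i : Fin n) : ∀ᶠ s in 𝓝 (0 : ℝ), 0 < 1 + s * d i :=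
      (show Continuous fun s : ℝ => 1 + s * d i by fun_prop).tendsto 0 |>.eventually
        (lt_mem_nhds (by simp))
    filter_upwards [eventually_all.2 hpos] with s hs
    ext i
    simp only [sqVec_apply, mul_pow, Real.sq_sqrt (hs i).le, PiLp.add_apply, PiLp.smul_apply,
      hadamard_apply, smul_eq_mul]
    ring

theorem inner_hadamard_le_of_mem_regularSubdiff {y v d : EuclideanSpace ℝ (Fin n)}
    {f' : EuclideanSpace ℝ (Fin n) →L[ℝ] ℝ} {G τ : ℝ} (hf : HasFDerivAt f f' (sqVec y))
    (hG : g (sqVec y) = G) (hv : v ∈ regularSubdiff (bigPhi f g) y)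
    (hd : ∀ᶠ s : ℝ in 𝓝[>] 0, g (sqVec y + s • hadamard (sqVec y) d) ≤ ((G + s * τ : ℝ) : EReal)) :
    2⁻¹ * inner ℝ v (hadamard y d) ≤ f' (hadamard (sqVec y) d) + τ := by
  obtain ⟨Y, hY, hY₀, hsq⟩ := exists_hasDerivAt_sqVec_eq y d
  have hray : HasDerivAt (fun s : ℝ => sqVec y + s • hadamard (sqVec y) d)
      (hadamard (sqVec y) d) 0 := by
    simpa using ((hasDerivAt_id (0 : ℝ)).smul_const (hadamard (sqVec y) d)).const_add (sqVec y)
  have hθ : HasDerivAt (fun s : ℝ => f (sqVec y + s • hadamard (sqVec y) d) + (G + s * τ))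
      (f' (hadamard (sqVec y) d) + τ) 0 := by
    refine HasDerivAt.add (HasFDerivAt.comp_hasDerivAt 0 (by simpa) hray) ?_
    simpa using ((hasDerivAt_id (0 : ℝ)).mul_const τ).const_add G
  rw [← real_inner_smul_right]
  refine inner_le_of_mem_regularSubdiff_of_hasDerivAt hv hY hY₀ hθ (by simp [bigPhi, hG]) ?_
  filter_upwards [hd, nhdsWithin_le_nhds hsq] with s hs hsq
  rw [bigPhi, hsq, EReal.coe_add]
  gcongr

theorem mem_regularSubdiff_phi {x u : EuclideanSpace ℝ (Fin n)}
    {f' : EuclideanSpace ℝ (Fin n) →L[ℝ] ℝ} {G : ℝ} (hf : HasFDerivAt f f' x) (hG : g x = G)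
    (hu : ∀ z, ∀ t : ℝ, g z ≤ t → G + (inner ℝ u (z - x) - f' (z - x)) ≤ t) :
    u ∈ regularSubdiff (phi f g) x := by
  have hval : phi f g x = ((f x + G : ℝ) : EReal) := by rw [phi, hG, EReal.coe_add]
  refine (mem_regularSubdiff_iff hval).2 fun ε hε => ?_
  filter_upwards [hf.isLittleO.def hε] with z hz t ht
  have hgz : g z ≤ ((t - f z : ℝ) : EReal) := by
    rw [EReal.coe_sub, EReal.le_sub_iff_add_le (by simp) (by simp), add_comm]
    exact ht
  rw [Real.norm_eq_abs] at hz
  linarith [hu z _ hgz, (abs_le.1 hz).1]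

theorem hadamard_single (w : EuclideanSpace ℝ (Fin n)) (i : Fin n) :
    hadamard w (EuclideanSpace.single i 1) = w i • EuclideanSpace.single i (1 : ℝ) := by
  ext j
  rcases eq_or_ne j i with rfl | hj <;> simp [*]

theorem exists_real_of_mem_regularSubdiff_bigPhi {y v : EuclideanSpace ℝ (Fin n)}
    (hv : v ∈ regularSubdiff (bigPhi f g) y) : ∃ G : ℝ, g (sqVec y) = G := by
  obtain ⟨r, hr⟩ := exists_real_of_mem_subdiff (regularSubdiff_subset_subdiff _ _ hv)
  induction hG : g (sqVec y) with
  | bot => simp [bigPhi, hG] at hr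
  | coe G => exact ⟨G, rfl⟩
  | top => simp [bigPhi, hG] at hr

/-- Where `y i = 0`, the equality may fail. -/
theorem exists_mem_regularSubdiff_phi {y v : EuclideanSpace ℝ (Fin n)}
    (hf : DifferentiableAt ℝ f (sqVec y)) (hg : IsPolyhedralFun g)
    (hv : v ∈ regularSubdiff (bigPhi f g) y) :
    ∃ u ∈ regularSubdiff (phi f g) (sqVec y), ∀ i, y i ≠ 0 → 2 * y i * u i = v i := by
  obtain ⟨f', hf⟩ := hf
  obtain ⟨G, hG⟩ := exists_real_of_mem_regularSubdiff_bigPhi hv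
  let Q := (hadamard (sqVec y)).prodMap (LinearMap.id : ℝ →ₗ[ℝ] ℝ)
  let c : EuclideanSpace ℝ (Fin n) × ℝ →ₗ[ℝ] ℝ :=
    ((2 : ℝ)⁻¹ • innerₛₗ ℝ v ∘ₗ hadamard y - f' ∘ₗ hadamard (sqVec y)).coprod (-LinearMap.id)
  obtain ⟨A, hA, hAQ⟩ := IsPolyhedralSet.exists_normal_comp_eq hg (p := (sqVec y, G)) hG.le Q c
    fun d hd => by
      have := inner_hadamard_le_of_mem_regularSubdiff (d := d.1) (τ := d.2) hf hG hv
        (by simpa [epi, Q] using hd)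
      simpa [c, add_comm] using this
  have hvert : A (0, 1) = -1 := by simpa [Q, c] using LinearMap.congr_fun hAQ (0, 1)
  let u := (InnerProductSpace.toDual ℝ _).symm
    (f' + LinearMap.toContinuousLinearMap (A ∘ₗ LinearMap.inl ℝ _ ℝ))
  have hu (d) : inner ℝ u d = f' d + A (d, 0) :=
    InnerProductSpace.toDual_symm_apply
  have hchain (d) : inner ℝ u (hadamard (sqVec y) d) = 2⁻¹ * inner ℝ v (hadamard y d) := by
    have : A (hadamard (sqVec y) d, 0) =
        2⁻¹ * inner ℝ v (hadamard y d) - f' (hadamard (sqVec y) d) := by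
      simpa [Q, c] using LinearMap.congr_fun hAQ (d, 0)
    rw [hu, this, add_sub_cancel]
  refine ⟨u, mem_regularSubdiff_phi hf hG fun z t ht => ?_, fun i hi => ?_⟩
  · have hsplit : (z, t) = (sqVec y, G) + ((z - sqVec y, 0) + (t - G) • (0, 1)) := by simp
    have := hA (z, t) ht
    rw [hsplit, map_add, map_add, map_smul, hvert, smul_eq_mul] at this
    linarith [hu (z - sqVec y)]
  · have hi' : y i ^ 2 * u i = 2⁻¹ * (y i * v i) := by
      simpa [hadamard_single, inner_smul_right, EuclideanSpace.inner_single_right]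
        using hchain (EuclideanSpace.single i 1)
    exact mul_left_cancel₀ hi (by linarith)

end Squaring

section BoxErrorBound

theorem exists_eventually_abs_sq_sub_le (t₀ : ℝ) :
    ∃ K > 0, ∀ᶠ t in 𝓝 t₀, ∀ w : ℝ, |t ^ 2 - w| ≤ 1 → (t₀ = 0 → |w| ≤ t ^ 2) →
      |t ^ 2 - w| ≤ K * |t| * √|t ^ 2 - w| := by
  have key {K t w : ℝ} (hK : 0 < K) (h : |t ^ 2 - w| ≤ (K * t) ^ 2) :
      |t ^ 2 - w| ≤ K * |t| * √|t ^ 2 - w| := by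
    have : √|t ^ 2 - w| ≤ K * |t| := by
      simpa [Real.sqrt_sq_eq_abs, abs_mul, abs_of_pos hK] using Real.sqrt_le_sqrt h
    calc |t ^ 2 - w| = √|t ^ 2 - w| * √|t ^ 2 - w| := (Real.mul_self_sqrt (abs_nonneg _)).symm
      _ ≤ K * |t| * √|t ^ 2 - w| := by gcongr
  rcases eq_or_ne t₀ 0 with rfl | ht₀
  · refine ⟨2, two_pos, Eventually.of_forall fun t w _ hw => key two_pos ?_⟩
    have := abs_sub (t ^ 2) w
    rw [abs_of_nonneg (sq_nonneg t)] at this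
    nlinarith [hw rfl]
  · refine ⟨2 / |t₀|, by positivity, ?_⟩
    filter_upwards [(continuous_abs.tendsto t₀).eventually
      (lt_mem_nhds (half_lt_self (abs_pos.2 ht₀)))] with t ht w hw _
    refine key (by positivity) (hw.trans ?_)
    rw [one_le_sq_iff_one_le_abs, abs_mul, abs_div, abs_two, abs_abs, div_mul_eq_mul_div,
      one_le_div (abs_pos.2 ht₀)]
    linarith

variable {n : ℕ}

theorem isClosed_box (x : EuclideanSpace ℝ (Fin n)) (J : Set (Fin n)) (ρ : Fin n → ℝ) :
    IsClosed (box x J ρ) := by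
  simp only [box, ofPred_forall]
  exact isClosed_iInter fun i => isClosed_iInter fun _ =>
    isClosed_le (by fun_prop) continuous_const

theorem exists_eventually_inner_sqVec_sub_le (y₀ : EuclideanSpace ℝ (Fin n)) :
    ∃ K > 0, ∀ᶠ y in 𝓝 y₀, ∀ z u v : EuclideanSpace ℝ (Fin n), dist (sqVec y) z ≤ 1 →
      (∀ i, y₀ i = 0 → |z i| ≤ y i ^ 2) → (∀ i, y i ≠ 0 → 2 * y i * u i = v i) →
      inner ℝ u (sqVec y - z) ≤ K * √(dist (sqVec y) z) * ‖v‖ := by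
  choose K hK hKy using fun i => exists_eventually_abs_sq_sub_le (y₀ i)
  refine ⟨∑ i, K i + 1, add_pos_of_nonneg_of_pos (Finset.sum_nonneg fun i _ => (hK i).le) one_pos,
    ?_⟩
  have hcoord (i : Fin n) := ((EuclideanSpace.proj (𝕜 := ℝ) i).continuous.tendsto y₀).eventually
    (hKy i)
  filter_upwards [eventually_all.2 hcoord] with y hy z u v hz hzbox huv
  have hterm (i : Fin n) : u i * (y i ^ 2 - z i) ≤ K i * (√(dist (sqVec y) z) * ‖v‖) := by
    have hzi : |y i ^ 2 - z i| ≤ dist (sqVec y) z := by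
      simpa [dist_eq_norm] using PiLp.norm_apply_le (sqVec y - z) i
    have hvi : |y i * u i| ≤ ‖v‖ := by
      rcases eq_or_ne (y i) 0 with hi | hi
      · simp [hi]
      · have := PiLp.norm_apply_le v i
        rw [← huv i hi, Real.norm_eq_abs, mul_assoc, abs_mul, abs_two] at this
        linarith [abs_nonneg (y i * u i)]
    have hKi := hK i
    calc u i * (y i ^ 2 - z i) ≤ |u i| * |y i ^ 2 - z i| := by
          rw [← abs_mul]; exact le_abs_self _
      _ ≤ |u i| * (K i * |y i| * √|y i ^ 2 - z i|) := by
          gcongr; exact hy i (z i) (hzi.trans hz) (hzbox i)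
      _ = K i * (√|y i ^ 2 - z i| * |y i * u i|) := by rw [abs_mul]; ring
      _ ≤ K i * (√(dist (sqVec y) z) * ‖v‖) := by gcongr
  calc inner ℝ u (sqVec y - z) = ∑ i, u i * (y i ^ 2 - z i) := by
        simp [PiLp.inner_apply, mul_comm]
    _ ≤ ∑ i, K i * (√(dist (sqVec y) z) * ‖v‖) := Finset.sum_le_sum fun i _ => hterm i
    _ ≤ (∑ i, K i + 1) * √(dist (sqVec y) z) * ‖v‖ := by
        rw [← Finset.sum_mul, mul_assoc]
        gcongr
        exact le_add_of_nonneg_right zero_le_one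

/-- The Hölder error bound for the solution set `argmin h` intersected with boxes around `x₀` that
only constrain the coordinates vanishing at `x₀`, uniformly in the size of the boxes. -/
def HasBoxErrorBound (h : EuclideanSpace ℝ (Fin n) → EReal) (x₀ : EuclideanSpace ℝ (Fin n))
    (γ : ℝ) : Prop :=
  ∃ U ∈ 𝓝 x₀, ∃ c : ℝ, 0 < c ∧ ∀ ρ : Fin n → ℝ, (∀ i, 0 ≤ ρ i) → ∀ x ∈ U ∩ domSubdiff h,
    Metric.infDist x (argmin h ∩ box x₀ {i | x₀ i ≠ 0}ᶜ ρ) ≤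
      c * max (Metric.infDist x (argmin h)) (Metric.infDist x (box x₀ {i | x₀ i ≠ 0}ᶜ ρ)) ^ γ

theorem HasBoxErrorBound.exists_mem_argmin_dist_le {h : EuclideanSpace ℝ (Fin n) → EReal}
    {x₀ : EuclideanSpace ℝ (Fin n)} {γ : ℝ} (herr : HasBoxErrorBound h x₀ γ)
    (hl : LowerSemicontinuous h) (hx₀ : x₀ ∈ argmin h) :
    ∃ c > 0, ∀ᶠ x in 𝓝 x₀, x ∈ domSubdiff h → ∃ z ∈ argmin h, (∀ i, x₀ i = 0 → |z i| ≤ |x i|) ∧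
      dist x z ≤ dist x x₀ ∧ dist x z ≤ c * Metric.infDist x (argmin h) ^ γ := by
  obtain ⟨U, hU, c, hc, herr⟩ := herr
  refine ⟨c, hc, ?_⟩
  filter_upwards [hU] with x hxU hx
  let S := box x₀ {i | x₀ i ≠ 0}ᶜ fun i => |x i - x₀ i|
  have hxS : x ∈ S := fun i _ => le_rfl
  have hx₀S : x₀ ∈ argmin h ∩ S := ⟨hx₀, fun i _ => by simp⟩
  have hclosed : IsClosed (argmin h ∩ S) := (isClosed_argmin hl).inter (isClosed_box ..)
  obtain ⟨z, ⟨hz, hzS⟩, hxz⟩ := hclosed.exists_infDist_eq_dist ⟨x₀, hx₀S⟩ x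
  refine ⟨z, hz, fun i hi => by simpa [hi] using hzS i (by simpa using hi), ?_, ?_⟩
  · exact hxz ▸ Metric.infDist_le_dist_of_mem hx₀S
  · have := herr (fun i => |x i - x₀ i|) (fun i => abs_nonneg _) x ⟨hxU, hx⟩
    rwa [hxz, Metric.infDist_zero_of_mem hxS, max_eq_left Metric.infDist_nonneg] at this

end BoxErrorBound

section SquareTransfer

theorem rpow_le_mul_of_le_mul_sqrt {s D N K c θ : ℝ} (hs : 0 < s) (hK : 0 ≤ K) (hN : 0 ≤ N)
    (hD : D ≤ c * s ^ θ) (hle : s ≤ K * √D * N) : s ^ (1 - θ / 2) ≤ K * √c * N := by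
  have hpow : 0 < s ^ (θ / 2) := Real.rpow_pos_of_pos hs _
  have hsq : √D ≤ √c * s ^ (θ / 2) := by
    rw [div_eq_mul_one_div, Real.rpow_mul hs.le, ← Real.sqrt_eq_rpow,
      ← Real.sqrt_mul' c (Real.rpow_nonneg hs.le θ)]
    exact Real.sqrt_le_sqrt hD
  rw [Real.rpow_sub hs, Real.rpow_one, div_le_iff₀ hpow]
  calc s ≤ K * √D * N := hle
    _ ≤ K * (√c * s ^ (θ / 2)) * N := by gcongr
    _ = K * √c * N * s ^ (θ / 2) := by ring

variable {n : ℕ} {f : EuclideanSpace ℝ (Fin n) → ℝ} {g : EuclideanSpace ℝ (Fin n) → EReal}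
  {y₀ : EuclideanSpace ℝ (Fin n)} {α γ m : ℝ}

theorem eventually_rpow_le_mul_norm_bigPhi (hf : Differentiable ℝ f)
    (hg : IsPolyhedralFun g) (hconv : IsConvexFun (phi f g)) (hm : phi f g (sqVec y₀) = m)
    (hmin : sqVec y₀ ∈ argmin (phi f g)) (hγ : 0 ≤ γ)
    (herr : HasBoxErrorBound (phi f g) (sqVec y₀) γ) (hKL : HasKLExponent (phi f g) (sqVec y₀) α) :
    ∃ c > 0, ∃ a > 0, ∀ᶠ y in 𝓝 y₀, ∀ r : ℝ, bigPhi f g y = r → m < r → r < m + a →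
      ∀ v ∈ regularSubdiff (bigPhi f g) y, (r - m) ^ (1 - γ * (1 - α) / 2) ≤ c * ‖v‖ := by
  obtain ⟨C, hC, a, ha, hdist⟩ := hKL.exists_infDist_argmin_le hm hmin
  obtain ⟨b, hb, hbox⟩ := herr.exists_mem_argmin_dist_le hKL.2.1 hmin
  obtain ⟨K, hK, hinner⟩ := exists_eventually_inner_sqVec_sub_le y₀
  refine ⟨K * √(b * C ^ γ), by positivity, a, ha, ?_⟩
  have hsq := continuous_sqVec.tendsto y₀
  filter_upwards [hsq.eventually hdist, hsq.eventually hbox, hinner,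
    hsq.eventually (Metric.closedBall_mem_nhds _ one_pos)]
    with y hdist hbox hinner hy r hr hmr hra v hv
  obtain ⟨u, hu, huv⟩ := exists_mem_regularSubdiff_phi (hf _) hg hv
  obtain ⟨z, hz, hzbox, hz₀, hzdist⟩ := hbox ⟨u, regularSubdiff_subset_subdiff _ _ hu⟩
  have hzm : phi f g z ≤ m := hm ▸ hz _
  have hgap : r - m ≤ K * √(dist (sqVec y) z) * ‖v‖ := by
    have hsub := hconv.add_inner_le_of_mem_regularSubdiff hr hu hzm
    have := hinner z u v (hz₀.trans hy) (fun i hi => by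
      simpa using hzbox i (by simpa using hi)) huv
    rw [← neg_sub, inner_neg_right] at this
    linarith
  have hD : dist (sqVec y) z ≤ b * C ^ γ * (r - m) ^ (γ * (1 - α)) := by
    have hs : 0 ≤ r - m := sub_nonneg.2 hmr.le
    rw [mul_comm γ, Real.rpow_mul hs, mul_assoc, ← Real.mul_rpow hC.le (Real.rpow_nonneg hs _)]
    refine hzdist.trans ?_
    gcongr
    exacts [Metric.infDist_nonneg, hdist r hr hra]
  exact rpow_le_mul_of_le_mul_sqrt (sub_pos.2 hmr) hK.le (norm_nonneg v) hD hgap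

end SquareTransfer

end SquareKL

open SquareKL in
theorem theorem6p2_general {n : ℕ} {f : EuclideanSpace ℝ (Fin n) → ℝ}
    {g : EuclideanSpace ℝ (Fin n) → EReal} (hf : Differentiable ℝ f) (hg : IsPolyhedralFun g)
    (hconv : IsConvexFun (phi f g)) {y₀ : EuclideanSpace ℝ (Fin n)}
    (hstat : IsStationary (phi f g) (sqVec y₀)) {α γ : ℝ} (hγ₀ : 0 < γ) (hγ₁ : γ ≤ 1)
    (herr : HasBoxErrorBound (phi f g) (sqVec y₀) γ)
    (hKL : HasKLExponent (phi f g) (sqVec y₀) α) :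
    HasKLExponent (bigPhi f g) y₀ ((1 + (1 - γ * (1 - α))) / 2) := by
  have hmin := hconv.mem_argmin_of_isStationary hstat
  have ⟨hproper, hl, _, hα₀, hα₁, _⟩ := hKL
  obtain ⟨m, hm⟩ := exists_real_of_mem_subdiff hstat
  have hzero : (0 : EuclideanSpace ℝ (Fin n)) ∈ subdiff (bigPhi f g) y₀ :=
    regularSubdiff_subset_subdiff _ _ <|
      zero_mem_regularSubdiff_of_mem_argmin hm fun z => hmin (sqVec z)
  have hexp : (1 + (1 - γ * (1 - α))) / 2 = 1 - γ * (1 - α) / 2 := by ring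
  have hγα : 0 < γ * (1 - α) := mul_pos hγ₀ (sub_pos.2 hα₁)
  rw [hexp, hasKLExponent_iff (show bigPhi f g y₀ = m from hm)]
  exact ⟨⟨⟨y₀, hm.trans_lt (EReal.coe_lt_top m)⟩, fun z => hproper.2 (sqVec z)⟩,
    LowerSemicontinuous.comp hl continuous_sqVec, ⟨0, hzero⟩, by nlinarith, by linarith,
    eventually_rpow_le_mul_norm_bigPhi hf hg hconv hm hmin hγ₀.le herr hKL⟩

theorem theorem6p2 {n : ℕ}
    (f : EuclideanSpace ℝ (Fin n) → ℝ) (g : EuclideanSpace ℝ (Fin n) → EReal)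
    (hf : ContDiff ℝ 2 f)
    (hg_proper : SquareKL.IsProper g) (hg_poly : SquareKL.IsPolyhedralFun g)
    (hg_dom : ∀ x ∈ SquareKL.dom g, ∀ i, 0 ≤ x i)
    (hconv : SquareKL.IsConvexFun (SquareKL.phi f g))
    (xbar ybar : EuclideanSpace ℝ (Fin n)) (hxy : xbar = SquareKL.sqVec ybar)
    (hstat : SquareKL.IsStationary (SquareKL.phi f g) xbar)
    (α γ : ℝ) (hα₀ : 0 < α) (hα₁ : α < 1) (hγ₀ : 0 < γ) (hγ₁ : γ ≤ 1)
    (herr : ∃ U ∈ 𝓝 xbar, ∃ c : ℝ, 0 < c ∧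
      ∀ ρ : Fin n → ℝ, (∀ i, 0 ≤ ρ i) →
        ∀ x ∈ U ∩ SquareKL.domSubdiff (SquareKL.phi f g),
          Metric.infDist x
              (SquareKL.argmin (SquareKL.phi f g) ∩ SquareKL.box xbar {i | xbar i ≠ 0}ᶜ ρ) ≤
            c * max (Metric.infDist x (SquareKL.argmin (SquareKL.phi f g)))
              (Metric.infDist x (SquareKL.box xbar {i | xbar i ≠ 0}ᶜ ρ)) ^ γ)
    (hKL : SquareKL.HasKLExponent (SquareKL.phi f g) xbar α) :
    SquareKL.HasKLExponent (SquareKL.bigPhi f g) ybar ((1 + (1 - γ * (1 - α))) / 2) := by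
  subst hxy
  exact theorem6p2_general (hf.differentiable (by norm_num)) hg_poly hconv hstat hγ₀ hγ₁ herr hKL
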